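/- Let $\mathbb F$ be an algebraically closed field and let $d\ge 1$. A set $\mathcal L$ of lines of the projective space $\mathrm{PG}(d,\mathbb F)$ is called a generator set (with respect to hyperplanes) if for every hyperplane $\Pi$ the set of those points of $\Pi$ that lie on at least one line of $\mathcal L$ spans $\Pi$. Let $\varphi:\{0,1,\dots,d\}\to\mathbb F$ be an injection with $\varphi(0)=0$ and $\varphi(1)=1$. For $t\in\mathbb F$, the diverted tangent line $\ell'_t$ (determined by $\varphi$) is the line of $\mathrm{PG}(d,\mathbb F)$ connecting the points with homogeneous coordinates $a(t)=(1,t,t^2,\dots,t^d)$ and $b(t)=(0,1,\varphi(2)t,\dots,\varphi(d)t^{d-1})$. Then the minimum size of a generator set of lines in $\mathrm{PG}(d,\mathbb F)$ is exactly $2d-1$. Moreover, for every such $\varphi$, any $2d-1$ distinct diverted tangent lines determined by $\varphi$ constitute a generator set of lines, and it is of this minimal size. -/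

import Mathlib

open scoped LinearAlgebra.Projectivization

/-- The projective space `PG(d, F)`: the one-dimensional subspaces of `F^(d+1)`. -/
abbrev PG (d : ℕ) (F : Type*) [Field F] : Type _ := ℙ F (Fin (d + 1) → F)

/-- The projective subspaces of `PG(d, F)`. -/
abbrev PGSubspace (d : ℕ) (F : Type*) [Field F] : Type _ :=
  Projectivization.Subspace F (Fin (d + 1) → F)

/-- A line: a projective subspace of dimension one (its linear subspace has dimension two). -/
def IsLine {d : ℕ} {F : Type*} [Field F] (l : PGSubspace d F) : Prop :=
  Module.finrank F (Projectivization.Subspace.submodule l) = 2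

/-- A hyperplane: a projective subspace of dimension `d - 1`
(its linear subspace has dimension `d`). -/
def IsHyperplane {d : ℕ} {F : Type*} [Field F] (P : PGSubspace d F) : Prop :=
  Module.finrank F (Projectivization.Subspace.submodule P) = d

/-- A set of points is a generator set (with respect to hyperplanes) if it meets every hyperplane
in a set of points that spans this hyperplane. -/
def IsGeneratorSet {d : ℕ} {F : Type*} [Field F] (G : Set (PG d F)) : Prop :=
  ∀ P : PGSubspace d F, IsHyperplane P →
    Projectivization.Subspace.span (G ∩ (P : Set (PG d F))) = P

/-- A set of lines is a generator set if the set of all points of its lines is one. -/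
def IsGeneratorSetOfLines {d : ℕ} {F : Type*} [Field F] (L : Set (PGSubspace d F)) : Prop :=
  (∀ l ∈ L, IsLine l) ∧ IsGeneratorSet (⋃ l ∈ L, (l : Set (PG d F)))

/-- The affine point `a(t) = (1, t, t^2, …, t^d)` of the moment curve. -/
def momentPoint (d : ℕ) {F : Type*} [Field F] (t : F) : Fin (d + 1) → F :=
  fun j => t ^ (j : ℕ)

/-- The point `b(t) = (0, φ(1), φ(2) t, …, φ(d) t^(d-1))` of the ideal hyperplane. -/
def divertedDirection {d : ℕ} {F : Type*} [Field F] (φ : Fin (d + 1) → F) (t : F) :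
    Fin (d + 1) → F :=
  Fin.cons (α := fun _ => F) 0 (fun j : Fin d => φ j.succ * t ^ (j : ℕ))

/-- The diverted tangent line connecting the points `a(t)` and `b(t)`. -/
def divertedTangent {d : ℕ} {F : Type*} [Field F] (φ : Fin (d + 1) → F) (t : F) :
    PGSubspace d F :=
  Projectivization.Subspace.submodule.symm
    (Submodule.span F {momentPoint d t, divertedDirection φ t})

/-! Lower bound: a line spanned by `u`, `v` meets the codimension-two space `f = g = 0` iff the 2 ×
2 determinant of the values of `f`, `g` at `u`, `v` vanishes, a linear condition on the Plücker
coordinates of `f ∧ g`. The cone over the Grassmannian has dimension at least `2d - 1`, so by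
Krull's height theorem at most `2d - 2` such conditions have a common zero besides the vertex
(`exists_isotropic_pair`). A general hyperplane of the pencil of `f`, `g` then meets the lines only
inside `f = g = 0`, and these points do not span it.

Upper bound: if the points on a hyperplane `g = 0` do not span it, a form `f` independent of `g`
vanishes at all of them. Then the determinant of `f`, `g` at `a(t)`, `b(t)` vanishes for each line
used. It is a nonzero polynomial in `t` of degree at most `2d - 2` (`encard_minor_eq_zero_lt`), so
it cannot have `2d - 1` roots. -/

open MvPolynomial in
/-- The `2 × 2` minor on columns `i`, `j` of the generic matrix with two rows. -/
noncomputable def genericMinor (F : Type*) [Field F] {n : ℕ} (i j : Fin n) :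
    MvPolynomial (Fin n ⊕ Fin n) F :=
  X (Sum.inl i) * X (Sum.inr j) - X (Sum.inl j) * X (Sum.inr i)

/-- The homogeneous coordinate ring of the Grassmannian of lines, as the algebra generated by the
`2 × 2` minors of the generic matrix with two rows. -/
noncomputable def pluckerAlgebra (F : Type*) [Field F] (n : ℕ) :
    Subalgebra F (MvPolynomial (Fin n ⊕ Fin n) F) :=
  Algebra.adjoin F (Set.range fun p : Fin n × Fin n => genericMinor F p.1 p.2)

/-- The minors as elements of the algebra they generate. -/
noncomputable def pluckerCoord (F : Type*) [Field F] {n : ℕ} (i j : Fin n) :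
    pluckerAlgebra F n :=
  ⟨genericMinor F i j, Algebra.subset_adjoin ⟨(i, j), rfl⟩⟩

instance (F : Type*) [Field F] (n : ℕ) : Algebra.FiniteType F (pluckerAlgebra F n) :=
  (Subalgebra.fg_iff_finiteType _).1 (Subalgebra.fg_def.2 ⟨_, Set.finite_range _, rfl⟩)

theorem pluckerAlgebra_algHom_ext {F : Type*} [Field F] {n : ℕ} {B : Type*} [CommRing B]
    [Algebra F B] {χ ψ : pluckerAlgebra F n →ₐ[F] B}
    (h : ∀ i j, χ (pluckerCoord F i j) = ψ (pluckerCoord F i j)) : χ = ψ := by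
  refine AlgHom.adjoin_ext ?_
  rintro _ ⟨⟨i, j⟩, rfl⟩
  exact h i j

/-! ### Schubert ideals and a chain of primes below the vertex -/

open MvPolynomial in
/-- The substitution restricting the two rows to their first `a + 1` and `b + 1` entries. -/
noncomputable def truncateRows (F : Type*) [Field F] (n a b : ℕ) :
    MvPolynomial (Fin n ⊕ Fin n) F →ₐ[F] MvPolynomial (Fin n ⊕ Fin n) F :=
  aeval (Sum.elim (fun i => if (i : ℕ) ≤ a then X (Sum.inl i) else 0)
    (fun i => if (i : ℕ) ≤ b then X (Sum.inr i) else 0))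

theorem truncateRows_comp {F : Type*} [Field F] {n a b a' b' : ℕ} (ha : a ≤ a') (hb : b ≤ b') :
    (truncateRows F n a b).comp (truncateRows F n a' b') = truncateRows F n a b := by
  refine MvPolynomial.algHom_ext fun i => ?_
  rcases i with i | i
  · by_cases h : (i : ℕ) ≤ a'
    · simp [truncateRows, h]
    · have : ¬ (i : ℕ) ≤ a := by omega
      simp [truncateRows, h, this]
  · by_cases h : (i : ℕ) ≤ b'
    · simp [truncateRows, h]
    · have : ¬ (i : ℕ) ≤ b := by omega
      simp [truncateRows, h, this]

/-- For `j > a` the entry `j` of the first row is killed, so only one of the two terms of the minor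
can survive. -/
theorem truncateRows_genericMinor {F : Type*} [Field F] {n a b : ℕ} {i j : Fin n}
    (hj : a < j) :
    truncateRows F n a b (genericMinor F i j) =
      if (i : ℕ) ≤ a ∧ (j : ℕ) ≤ b then
        MvPolynomial.X (Sum.inl i) * MvPolynomial.X (Sum.inr j) else 0 := by
  have : ¬ (j : ℕ) ≤ a := by omega
  by_cases h1 : (i : ℕ) ≤ a <;> by_cases h2 : (j : ℕ) ≤ b <;>
    simp [truncateRows, genericMinor, h1, h2, this]

/-- The ideal of a Schubert variety. -/
noncomputable def schubertIdeal (F : Type*) [Field F] (n a b : ℕ) : Ideal (pluckerAlgebra F n) :=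
  RingHom.ker ((truncateRows F n a b).comp (pluckerAlgebra F n).val)

instance (F : Type*) [Field F] (n a b : ℕ) : (schubertIdeal F n a b).IsPrime :=
  RingHom.ker_isPrime _

theorem pluckerCoord_mem_schubertIdeal_iff {F : Type*} [Field F] {n a b : ℕ} {i j : Fin n}
    (hj : a < j) :
    pluckerCoord F i j ∈ schubertIdeal F n a b ↔ ¬ ((i : ℕ) ≤ a ∧ (j : ℕ) ≤ b) := by
  have : pluckerCoord F i j ∈ schubertIdeal F n a b ↔
      truncateRows F n a b (genericMinor F i j) = 0 := Iff.rfl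
  rw [this, truncateRows_genericMinor hj]
  split_ifs with h <;> simp [h, MvPolynomial.X_ne_zero]

theorem schubertIdeal_anti {F : Type*} [Field F] {n a b a' b' : ℕ} (ha : a ≤ a') (hb : b ≤ b') :
    schubertIdeal F n a' b' ≤ schubertIdeal F n a b := by
  intro x hx
  change truncateRows F n a b x = 0
  rw [← truncateRows_comp ha hb, AlgHom.comp_apply]
  have : truncateRows F n a' b' x = 0 := hx
  rw [this, map_zero]

/-- The vertex ideal of the cone over the Grassmannian. -/
noncomputable def vertexIdeal (F : Type*) [Field F] (n : ℕ) : Ideal (pluckerAlgebra F n) :=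
  RingHom.ker ((MvPolynomial.aeval fun _ => (0 : F)).comp (pluckerAlgebra F n).val)

instance (F : Type*) [Field F] (n : ℕ) : (vertexIdeal F n).IsPrime :=
  RingHom.ker_isPrime _

theorem pluckerCoord_mem_vertexIdeal {F : Type*} [Field F] {n : ℕ} (i j : Fin n) :
    pluckerCoord F i j ∈ vertexIdeal F n := by
  change MvPolynomial.aeval (fun _ => (0 : F)) (genericMinor F i j) = 0
  simp [genericMinor]

theorem schubertIdeal_le_vertexIdeal {F : Type*} [Field F] {n a b : ℕ} :
    schubertIdeal F n a b ≤ vertexIdeal F n := by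
  intro x hx
  change MvPolynomial.aeval (fun _ => (0 : F)) (x : MvPolynomial (Fin n ⊕ Fin n) F) = 0
  have h : (MvPolynomial.aeval (fun _ => (0 : F))).comp (truncateRows F n a b) =
      MvPolynomial.aeval (R := F) (σ := Fin n ⊕ Fin n) (fun _ => (0 : F)) := by
    refine MvPolynomial.algHom_ext fun i => ?_
    rcases i with i | i <;> simp only [truncateRows, AlgHom.comp_apply, MvPolynomial.aeval_X,
      Sum.elim_inl, Sum.elim_inr] <;> split_ifs <;> simp
  rw [← h, AlgHom.comp_apply]
  have : truncateRows F n a b x = 0 := hx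
  rw [this, map_zero]

/-- The coordinate with indices `0`, `b + 1` separates the two ideals. -/
theorem schubertIdeal_lt_of_lt_right {F : Type*} [Field F] {n b : ℕ} (hb : b + 1 < n) :
    schubertIdeal F n 0 (b + 1) < schubertIdeal F n 0 b := by
  refine lt_of_le_not_ge (schubertIdeal_anti le_rfl (by omega)) fun h => ?_
  have hmem : pluckerCoord F ⟨0, by omega⟩ ⟨b + 1, hb⟩ ∈ schubertIdeal F n 0 b := by
    rw [pluckerCoord_mem_schubertIdeal_iff (by simp)]; simp
  have := h hmem
  rw [pluckerCoord_mem_schubertIdeal_iff (by simp)] at this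
  simp at this

theorem schubertIdeal_lt_of_lt_left {F : Type*} [Field F] {d a : ℕ} (ha : a + 1 < d) :
    schubertIdeal F (d + 1) (a + 1) d < schubertIdeal F (d + 1) a d := by
  refine lt_of_le_not_ge (schubertIdeal_anti (by omega) le_rfl) fun h => ?_
  have hmem : pluckerCoord F ⟨a + 1, by omega⟩ ⟨d, by omega⟩ ∈ schubertIdeal F (d + 1) a d := by
    rw [pluckerCoord_mem_schubertIdeal_iff (by simp; omega)]; simp
  have := h hmem
  rw [pluckerCoord_mem_schubertIdeal_iff (by simpa using ha)] at this
  simp at this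

theorem schubertIdeal_lt_vertexIdeal {F : Type*} [Field F] {d : ℕ} (hd : 1 ≤ d) :
    schubertIdeal F (d + 1) 0 1 < vertexIdeal F (d + 1) := by
  refine lt_of_le_not_ge schubertIdeal_le_vertexIdeal fun h => ?_
  have := h (pluckerCoord_mem_vertexIdeal ⟨0, by omega⟩ ⟨1, by omega⟩)
  rw [pluckerCoord_mem_schubertIdeal_iff (by simp)] at this
  simp at this

/-- First stretch of the chain: the first row shrinks while the second stays full. -/
theorem le_height_schubertIdeal_left {F : Type*} [Field F] {d : ℕ} (k : ℕ) (hk : k + 1 ≤ d) :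
    (k : ℕ∞) ≤ (schubertIdeal F (d + 1) (d - 1 - k) d).height := by
  induction k with
  | zero => simp
  | succ k ih =>
    have h := schubertIdeal_lt_of_lt_left (F := F) (d := d) (a := d - 1 - (k + 1)) (by omega)
    rw [show d - 1 - (k + 1) + 1 = d - 1 - k by omega] at h
    push_cast
    exact (add_le_add_left (ih (by omega)) 1).trans (Ideal.height_add_one_le_of_lt_of_isPrime h)

/-- Second stretch: the first row keeps a single entry and the second one shrinks. -/
theorem le_height_schubertIdeal_right {F : Type*} [Field F] {d : ℕ} (k : ℕ) (hk : k + 1 ≤ d) :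
    ((d - 1 + k : ℕ) : ℕ∞) ≤ (schubertIdeal F (d + 1) 0 (d - k)).height := by
  induction k with
  | zero =>
    have h := le_height_schubertIdeal_left (F := F) (d - 1) (show d - 1 + 1 ≤ d by omega)
    rw [Nat.sub_self] at h
    rw [Nat.add_zero, Nat.sub_zero]
    exact h
  | succ k ih =>
    have h := schubertIdeal_lt_of_lt_right (F := F) (n := d + 1) (b := d - (k + 1)) (by omega)
    rw [show d - (k + 1) + 1 = d - k by omega] at h
    rw [← add_assoc, Nat.cast_add, Nat.cast_one]
    exact (add_le_add_left (ih (by omega)) 1).trans (Ideal.height_add_one_le_of_lt_of_isPrime h)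

/-- Two stretches of `d - 1` steps and a last one, from a point of the Grassmannian to the vertex.
-/
theorem le_height_vertexIdeal {F : Type*} [Field F] {d : ℕ} (hd : 1 ≤ d) :
    ((2 * d - 1 : ℕ) : ℕ∞) ≤ (vertexIdeal F (d + 1)).height := by
  have h := le_height_schubertIdeal_right (F := F) (d := d) (d - 1) (by omega)
  rw [show d - (d - 1) = 1 by omega] at h
  rw [show 2 * d - 1 = (d - 1 + (d - 1)) + 1 by omega, Nat.cast_add, Nat.cast_one]
  exact (add_le_add_left h 1).trans
    (Ideal.height_add_one_le_of_lt_of_isPrime (schubertIdeal_lt_vertexIdeal hd))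

/-! ### Common zeros of linear forms on the Grassmannian -/

/-- The weak Nullstellensatz for algebras of finite type over an algebraically closed field. -/
theorem Ideal.IsMaximal.exists_algHom_ker_eq {F A : Type*} [Field F] [IsAlgClosed F] [CommRing A]
    [Algebra F A] [Algebra.FiniteType F A] (M : Ideal A) (hM : M.IsMaximal) :
    ∃ χ : A →ₐ[F] F, RingHom.ker χ = M := by
  let _ := Ideal.Quotient.field M
  have : Algebra.FiniteType F (A ⧸ M) :=
    Algebra.FiniteType.of_surjective (Ideal.Quotient.mkₐ F M) (Ideal.Quotient.mkₐ_surjective F M)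
  -- Zariski's lemma: the residue field is finite over `F`, hence equal to it.
  have : Module.Finite F (A ⧸ M) := finite_of_finite_type_of_isJacobsonRing F (A ⧸ M)
  let e : F ≃ₐ[F] A ⧸ M :=
    AlgEquiv.ofBijective (Algebra.ofId F (A ⧸ M)) IsAlgClosed.algebraMap_bijective_of_isIntegral
  refine ⟨(e.symm : (A ⧸ M) →ₐ[F] F).comp (Ideal.Quotient.mkₐ F M), ?_⟩
  ext x
  simp [RingHom.mem_ker, Ideal.Quotient.eq_zero_iff_mem]

/-- The Plücker relation, which makes a zero of the algebra decomposable. -/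
theorem pluckerCoord_mul {F : Type*} [Field F] {n : ℕ} (a b i j : Fin n) :
    pluckerCoord F a b * pluckerCoord F i j =
      pluckerCoord F a i * pluckerCoord F b j - pluckerCoord F a j * pluckerCoord F b i := by
  apply Subtype.ext
  change genericMinor F a b * genericMinor F i j =
      genericMinor F a i * genericMinor F b j - genericMinor F a j * genericMinor F b i
  simp only [genericMinor]
  ring

/-- A nonzero point of the cone over the Grassmannian is given by two independent vectors. -/
theorem exists_minor_eq {F : Type*} [Field F] {n : ℕ} (χ : pluckerAlgebra F n →ₐ[F] F)
    {a b : Fin n} (hab : χ (pluckerCoord F a b) ≠ 0) :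
    ∃ f g : Fin n → F, ∀ i j, f i * g j - f j * g i = χ (pluckerCoord F i j) := by
  refine ⟨fun i => χ (pluckerCoord F a i),
    fun i => (χ (pluckerCoord F a b))⁻¹ * χ (pluckerCoord F b i), fun i j => ?_⟩
  have h := congrArg χ (pluckerCoord_mul a b i j)
  simp only [map_mul, map_sub] at h
  field_simp
  linear_combination -h

/-- Over an algebraically closed field, `2 d - 2` decomposable alternating forms on a space of
dimension `d + 1` have a common isotropic plane. -/
theorem exists_isotropic_pair {F : Type*} [Field F] [IsAlgClosed F] {d : ℕ} (hd : 1 ≤ d)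
    {ι : Type*} [Finite ι] (hι : Nat.card ι < 2 * d - 1) (u v : ι → Fin (d + 1) → F) :
    ∃ f g : Fin (d + 1) → F, (∃ i j, f i * g j - f j * g i ≠ 0) ∧
      ∀ k, (f ⬝ᵥ u k) * (g ⬝ᵥ v k) = (f ⬝ᵥ v k) * (g ⬝ᵥ u k) := by
  -- At `f ∧ g` this takes the value `(f ⬝ᵥ u k) * (g ⬝ᵥ v k) - (f ⬝ᵥ v k) * (g ⬝ᵥ u k)`.
  let ω : ι → pluckerAlgebra F (d + 1) := fun k =>
    ∑ i, ∑ j, (u k i * v k j) • pluckerCoord F i j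
  by_contra hcon
  have hmax : ∀ M : Ideal (pluckerAlgebra F (d + 1)), M.IsMaximal →
      Ideal.span (Set.range ω) ≤ M → M = vertexIdeal F (d + 1) := by
    intro M hM hle
    obtain ⟨χ, rfl⟩ := Ideal.IsMaximal.exists_algHom_ker_eq (F := F) M hM
    have hzero : ∀ i j, χ (pluckerCoord F i j) = 0 := by
      by_contra! hne
      obtain ⟨a, b, hab⟩ := hne
      obtain ⟨f, g, hfg⟩ := exists_minor_eq χ hab
      refine hcon ⟨f, g, ⟨a, b, by rw [hfg]; exact hab⟩, fun k => ?_⟩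
      have hk : χ (ω k) = 0 := hle (Ideal.subset_span ⟨k, rfl⟩)
      simp only [ω, map_sum, map_smul, smul_eq_mul, ← hfg] at hk
      rw [← sub_eq_zero, ← hk]
      simp only [dotProduct, Finset.sum_mul_sum]
      rw [← Finset.sum_sub_distrib]
      have hswap : (∑ i, ∑ j, f i * v k i * (g j * u k j)) =
        ∑ i, ∑ j, f j * v k j * (g i * u k i) := Finset.sum_comm
      rw [Finset.sum_sub_distrib, hswap, ← Finset.sum_sub_distrib]
      refine Finset.sum_congr rfl fun i _ => ?_
      rw [← Finset.sum_sub_distrib]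
      exact Finset.sum_congr rfl fun j _ => by ring
    have : χ = (MvPolynomial.aeval fun _ => (0 : F)).comp (pluckerAlgebra F (d + 1)).val :=
      pluckerAlgebra_algHom_ext fun i j =>
        (hzero i j).trans (pluckerCoord_mem_vertexIdeal i j).symm
    rw [this]
    rfl
  have hle : Ideal.span (Set.range ω) ≤ vertexIdeal F (d + 1) := by
    rw [Ideal.span_le]
    rintro _ ⟨k, rfl⟩
    exact Ideal.sum_mem _ fun i _ => Ideal.sum_mem _ fun j _ =>
      Submodule.smul_of_tower_mem _ _ (pluckerCoord_mem_vertexIdeal i j)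
  have : IsJacobsonRing (pluckerAlgebra F (d + 1)) := isJacobsonRing_of_finiteType (A := F)
  have : IsNoetherianRing (pluckerAlgebra F (d + 1)) := Algebra.FiniteType.isNoetherianRing F _
  have hmin : vertexIdeal F (d + 1) ∈ (Ideal.span (Set.range ω)).minimalPrimes := by
    refine ⟨⟨inferInstance, hle⟩, fun q ⟨hq, hIq⟩ _ => ?_⟩
    -- A prime is the intersection of the maximal ideals above it, and here each of these is the
    -- vertex ideal.
    rw [← IsJacobsonRing.out ‹_› (Ideal.IsPrime.isRadical hq)]
    exact le_sInf fun M ⟨hqM, hM⟩ => (hmax M hM (hIq.trans hqM)).ge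
  have h1 := (le_height_vertexIdeal (F := F) hd).trans
    (Ideal.height_le_card_of_mem_minimalPrimes_span (Set.finite_range ω) hmin)
  have h2 : (Set.range ω).ncard ≤ Nat.card ι := by
    rw [← Set.image_univ, ← Set.ncard_univ]
    exact Set.ncard_image_le Set.finite_univ
  have h3 := ENat.natCast_le_natCast.1 h1
  omega

/-! ### The lower bound -/

theorem exists_span_pair_of_isLine {d : ℕ} {F : Type*} [Field F] {l : PGSubspace d F}
    (hl : IsLine l) :
    ∃ u v : Fin (d + 1) → F,
      Projectivization.Subspace.submodule l = Submodule.span F {u, v} := by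
  let b := Module.finBasisOfFinrankEq F (Projectivization.Subspace.submodule l) hl
  refine ⟨b 0, b 1, ?_⟩
  have h := congrArg (Submodule.map (Submodule.subtype _)) b.span_eq
  rw [Submodule.map_span, Submodule.map_top, Submodule.range_subtype, ← Set.range_comp] at h
  refine h.symm.trans ?_
  congr 1
  ext x
  simp [eq_comm]

/-- Points meeting a hyperplane in a proper subspace are witnessed by a second hyperplane. -/
theorem isGeneratorSet_witness {d : ℕ} {F : Type*} [Field F] {G : Set (PG d F)}
    (hG : IsGeneratorSet G) {h g : Fin (d + 1) → F}
    (hgen : ∀ (x : Fin (d + 1) → F) (hx : x ≠ 0), Projectivization.mk F x hx ∈ G →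
      h ⬝ᵥ x = 0 → g ⬝ᵥ x = 0) (i j : Fin (d + 1)) : h i * g j = h j * g i := by
  by_cases hne : h = 0
  · simp [hne]
  have hne' : dotProductEquiv F (Fin (d + 1)) h ≠ 0 := by simpa using hne
  have hP : IsHyperplane (Projectivization.Subspace.submodule.symm
      (LinearMap.ker (dotProductEquiv F (Fin (d + 1)) h))) := by
    have := Module.Dual.finrank_ker_add_one_of_ne_zero hne'
    rw [Module.finrank_fin_fun] at this
    rw [IsHyperplane, OrderIso.apply_symm_apply]
    omega
  have hspan := (hG _ hP).ge
  have hle : Projectivization.Subspace.submodule.symm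
      (LinearMap.ker (dotProductEquiv F (Fin (d + 1)) h)) ≤
      Projectivization.Subspace.submodule.symm
      (LinearMap.ker (dotProductEquiv F (Fin (d + 1)) g)) := by
    refine hspan.trans (Projectivization.Subspace.span_le_subspace_iff.2 ?_)
    rintro p ⟨hpG, hp⟩
    induction p using Projectivization.ind with
    | h x hx => exact hgen x hx hpG hp
  have hle' := Projectivization.Subspace.submodule.symm.le_iff_le.1 hle
  have hmem : (Pi.single i (h j) - Pi.single j (h i) : Fin (d + 1) → F) ∈
      LinearMap.ker (dotProductEquiv F (Fin (d + 1)) h) := by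
    simp [mul_comm]
  have := hle' hmem
  simp only [LinearMap.mem_ker, dotProductEquiv_apply_apply, dotProduct_sub,
    dotProduct_single] at this
  linear_combination -this

/-- Over an algebraically closed field a generator set of lines has at least `2 d - 1` lines. -/
theorem le_encard_of_isGeneratorSetOfLines {F : Type*} [Field F] [IsAlgClosed F] {d : ℕ}
    (hd : 1 ≤ d) {L : Set (PGSubspace d F)} (hL : IsGeneratorSetOfLines L) :
    ((2 * d - 1 : ℕ) : ℕ∞) ≤ L.encard := by
  by_contra! hlt
  have hfin : L.Finite := Set.encard_lt_top_iff.1 (hlt.trans_le le_top)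
  have : Finite L := hfin
  have hcard : Nat.card L < 2 * d - 1 := by
    rw [← hfin.cast_ncard_eq] at hlt
    exact_mod_cast hlt
  choose u v huv using fun l : L => exists_span_pair_of_isLine (hL.1 l l.2)
  obtain ⟨f, g, ⟨i, j, hij⟩, hfg⟩ := exists_isotropic_pair hd hcard u v
  have hprop : ∀ (l : L), ∀ x ∈ Projectivization.Subspace.submodule l.1,
      ∀ y ∈ Projectivization.Subspace.submodule l.1,
      (f ⬝ᵥ x) * (g ⬝ᵥ y) = (f ⬝ᵥ y) * (g ⬝ᵥ x) := by
    intro l x hx y hy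
    rw [huv, Submodule.mem_span_pair] at hx hy
    obtain ⟨a, b, rfl⟩ := hx
    obtain ⟨a', b', rfl⟩ := hy
    simp only [dotProduct_add, dotProduct_smul, smul_eq_mul]
    linear_combination (a * b' - b * a') * hfg l
  -- The parameters `c` for which `f + c • g` vanishes at a point of `l` off `g = 0`. There is at
  -- most one per line, because `f` and `g` are proportional on `l`.
  let bad : L → Set F := fun l =>
    {c | ∃ x ∈ Projectivization.Subspace.submodule l.1, g ⬝ᵥ x ≠ 0 ∧ f ⬝ᵥ x + c * (g ⬝ᵥ x) = 0}
  have hbad : ∀ l, (bad l).Subsingleton := by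
    rintro l c ⟨x, hx, hgx, hcx⟩ c' ⟨y, hy, hgy, hcy⟩
    have h := hprop l x hx y hy
    have : (c - c') * ((g ⬝ᵥ x) * (g ⬝ᵥ y)) = 0 := by
      linear_combination (g ⬝ᵥ y) * hcx - (g ⬝ᵥ x) * hcy - h
    exact sub_eq_zero.1 ((mul_eq_zero.1 this).resolve_right (mul_ne_zero hgx hgy))
  have : Infinite F := IsAlgClosed.instInfinite
  obtain ⟨c, hc⟩ := (Set.finite_iUnion fun l => (hbad l).finite).exists_notMem
  have hgen := isGeneratorSet_witness hL.2 (h := f + c • g) (g := g) ?_ i j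
  · apply hij
    simp only [Pi.add_apply, Pi.smul_apply, smul_eq_mul] at hgen
    linear_combination hgen
  · intro x hx hxG hfx
    by_contra hgx
    obtain ⟨l, hl, hxl⟩ := Set.mem_iUnion₂.1 hxG
    refine hc (Set.mem_iUnion.2 ⟨⟨l, hl⟩, x, ?_, hgx, ?_⟩)
    · exact (Projectivization.Subspace.mem_submodule_iff l hx).2 hxl
    · simpa [add_dotProduct, smul_dotProduct] using hfx

/-! ### Polynomials attached to pairs of forms -/

/-- The polynomial with the given coefficient vector. -/
noncomputable def vecPoly {R : Type*} [Semiring R] {n : ℕ} (f : Fin n → R) : Polynomial R :=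
  ∑ i : Fin n, Polynomial.monomial (i : ℕ) (f i)

theorem vecPoly_coeff {R : Type*} [Semiring R] {n : ℕ} (f : Fin n → R) (i : Fin n) :
    (vecPoly f).coeff i = f i := by
  simp [vecPoly, Polynomial.finsetSum_coeff, Polynomial.coeff_monomial, Fin.val_inj]

theorem vecPoly_coeff_of_le {R : Type*} [Semiring R] {n : ℕ} (f : Fin n → R) {k : ℕ}
    (hk : n ≤ k) : (vecPoly f).coeff k = 0 := by
  rw [vecPoly, Polynomial.finsetSum_coeff]
  exact Finset.sum_eq_zero fun i _ => Polynomial.coeff_monomial_of_ne _ (by omega)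

theorem vecPoly_natDegree_le {R : Type*} [Semiring R] {d : ℕ} (f : Fin (d + 1) → R) :
    (vecPoly f).natDegree ≤ d :=
  Polynomial.natDegree_le_iff_coeff_eq_zero.2 fun _ hk => vecPoly_coeff_of_le f hk

theorem vecPoly_eval {R : Type*} [CommSemiring R] {n : ℕ} (f : Fin n → R) (t : R) :
    (vecPoly f).eval t = ∑ i, f i * t ^ (i : ℕ) := by
  simp [vecPoly, Polynomial.eval_finsetSum]

theorem vecPoly_sub_smul {R : Type*} [CommRing R] {n : ℕ} (f g : Fin n → R) (c : R) :
    vecPoly (f - c • g) = vecPoly f - Polynomial.C c * vecPoly g := by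
  simp [vecPoly, Finset.mul_sum, Polynomial.C_mul_monomial]

/-- If the vectors `f`, `g` are independent, then so are, generically, the two rows formed by the
polynomials of `f`, `g` and their distortions by an injective weight. -/
theorem vecPoly_minor_ne_zero {F : Type*} [Field F] {d : ℕ} {φ : Fin (d + 1) → F}
    (hφ : Function.Injective φ) {f g : Fin (d + 1) → F} (hg : g ≠ 0) (hfg : ∀ c : F, f ≠ c • g) :
    vecPoly f * vecPoly (φ * g) - vecPoly g * vecPoly (φ * f) ≠ 0 := by
  intro h0
  have hex : ∀ p : Fin (d + 1) → F, p ≠ 0 → ∃ a : Fin (d + 1),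
      p a ≠ 0 ∧ ∀ i, a < i → p i = 0 := by
    classical
    intro p hp
    obtain ⟨i, hi⟩ := Function.ne_iff.1 hp
    let s := Finset.univ.filter fun i => p i ≠ 0
    have hs : s.Nonempty := ⟨i, by simpa [s] using hi⟩
    refine ⟨s.max' hs, by simpa [s] using s.max'_mem hs, fun k hk => ?_⟩
    by_contra hne
    exact absurd (s.le_max' k (by simpa [s] using hne)) (not_le.2 hk)
  have hdeg : ∀ (p : Fin (d + 1) → F) (a : Fin (d + 1)), (∀ i, a < i → p i = 0) →
      (vecPoly p).natDegree ≤ a := by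
    intro p a hp
    refine Polynomial.natDegree_le_iff_coeff_eq_zero.2 fun k hk => ?_
    by_cases hkd : k < d + 1
    · exact (vecPoly_coeff p ⟨k, hkd⟩).trans (hp _ hk)
    · exact vecPoly_coeff_of_le p (by omega)
  obtain ⟨b, hb, hb'⟩ := hex g hg
  -- Subtracting a multiple of `g` does not change the determinant and makes the last nonzero index
  -- `a` of `f'` differ from `b`. The coefficient at `a + b` is then `(φ b - φ a) * (f' a * g b)`.
  set f' := f - (f b / g b) • g with hf'
  obtain ⟨a, ha, ha'⟩ := hex f' (sub_ne_zero.2 (hfg _))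
  have hfb : f' b = 0 := by simp [hf', hb]
  have hmul : φ * f' = φ * f - (f b / g b) • (φ * g) := by
    rw [hf', mul_sub, mul_smul_comm]
  have h1 : vecPoly f' * vecPoly (φ * g) = vecPoly g * vecPoly (φ * f') := by
    rw [hmul, hf', vecPoly_sub_smul, vecPoly_sub_smul]
    linear_combination h0
  have h2 := congrArg (fun p => Polynomial.coeff p ((a : ℕ) + b)) h1
  rw [Polynomial.coeff_mul_add_eq_of_natDegree_le (hdeg _ _ ha')
    (hdeg _ _ fun i hi => by simp [hb' i hi]), add_comm (a : ℕ),
    Polynomial.coeff_mul_add_eq_of_natDegree_le (hdeg _ _ hb')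
    (hdeg _ _ fun i hi => by simp [ha' i hi])] at h2
  simp only [vecPoly_coeff, Pi.mul_apply] at h2
  have h3 : (φ b - φ a) * (f' a * g b) = 0 := by linear_combination h2
  have h4 := hφ (sub_eq_zero.1 ((mul_eq_zero.1 h3).resolve_right (mul_ne_zero ha hb)))
  exact ha (h4 ▸ hfb)

theorem vecPoly_eval_momentPoint {F : Type*} [Field F] {d : ℕ} (f : Fin (d + 1) → F) (t : F) :
    (vecPoly f).eval t = f ⬝ᵥ momentPoint d t :=
  vecPoly_eval f t

/-- The polynomial whose values are the values of a form at the points `b(t)`. -/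
noncomputable def divertedPoly {F : Type*} [Field F] {d : ℕ} (φ f : Fin (d + 1) → F) :
    Polynomial F :=
  vecPoly fun j : Fin d => φ j.succ * f j.succ

theorem divertedPoly_eval {F : Type*} [Field F] {d : ℕ} (φ f : Fin (d + 1) → F) (t : F) :
    (divertedPoly φ f).eval t = f ⬝ᵥ divertedDirection φ t := by
  rw [divertedPoly, vecPoly_eval, dotProduct, Fin.sum_univ_succ]
  simp only [divertedDirection, Fin.cons_zero, Fin.cons_succ, mul_zero, zero_add]
  exact Finset.sum_congr rfl fun j _ => by ring

/-- As `φ 0 = 0`, no constant term is missing and the index shift is multiplication by `X`. -/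
theorem X_mul_divertedPoly {F : Type*} [Field F] {d : ℕ} {φ : Fin (d + 1) → F} (h0 : φ 0 = 0)
    (f : Fin (d + 1) → F) : Polynomial.X * divertedPoly φ f = vecPoly (φ * f) := by
  simp [divertedPoly, vecPoly, Fin.sum_univ_succ, h0, Finset.mul_sum, Polynomial.X_mul_monomial]

/-- Two independent forms are proportional on at most `2 d - 2` diverted tangent lines. -/
theorem encard_minor_eq_zero_lt {F : Type*} [Field F] {d : ℕ} (hd : 1 ≤ d) {φ : Fin (d + 1) → F}
    (hφ : Function.Injective φ) (h0 : φ 0 = 0) {f g : Fin (d + 1) → F} (hg : g ≠ 0)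
    (hfg : ∀ c : F, f ≠ c • g) :
    {t | (f ⬝ᵥ momentPoint d t) * (g ⬝ᵥ divertedDirection φ t) =
      (g ⬝ᵥ momentPoint d t) * (f ⬝ᵥ divertedDirection φ t)}.encard < ((2 * d - 1 : ℕ) : ℕ∞) := by
  classical
  set D := vecPoly f * divertedPoly φ g - vecPoly g * divertedPoly φ f with hD
  have hXD : Polynomial.X * D = vecPoly f * vecPoly (φ * g) - vecPoly g * vecPoly (φ * f) := by
    rw [hD, ← X_mul_divertedPoly h0, ← X_mul_divertedPoly h0]
    ring
  have hD0 : D ≠ 0 := fun h => vecPoly_minor_ne_zero hφ hg hfg (by rw [← hXD, h, mul_zero])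
  have hcoeff : ∀ k, 2 * d - 2 < k → D.coeff k = 0 := by
    intro k hk
    rw [← Polynomial.coeff_X_mul, hXD]
    -- The coefficient at `2d` cancels, as both products carry the same factor `φ d`; dividing by
    -- `X` brings the degree down to `2d - 2`.
    rcases eq_or_lt_of_le (show d + d ≤ k + 1 by omega) with h | h
    · rw [← h, Polynomial.coeff_sub,
        Polynomial.coeff_mul_add_eq_of_natDegree_le (vecPoly_natDegree_le _)
          (vecPoly_natDegree_le _),
        Polynomial.coeff_mul_add_eq_of_natDegree_le (vecPoly_natDegree_le _)
          (vecPoly_natDegree_le _)]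
      have hl : ∀ p : Fin (d + 1) → F, (vecPoly p).coeff d = p (Fin.last d) :=
        fun p => vecPoly_coeff p (Fin.last d)
      simp only [hl, Pi.mul_apply]
      ring
    · refine Polynomial.coeff_eq_zero_of_natDegree_lt (lt_of_le_of_lt ?_ h)
      have hmul : ∀ p q : Fin (d + 1) → F, (vecPoly p * vecPoly q).natDegree ≤ d + d := fun p q =>
        Polynomial.natDegree_mul_le_of_le (vecPoly_natDegree_le p) (vecPoly_natDegree_le q)
      exact (Polynomial.natDegree_sub_le _ _).trans (max_le (hmul _ _) (hmul _ _))
  have hdeg : D.natDegree ≤ 2 * d - 2 := Polynomial.natDegree_le_iff_coeff_eq_zero.2 hcoeff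
  have hsub : {t | (f ⬝ᵥ momentPoint d t) * (g ⬝ᵥ divertedDirection φ t) =
      (g ⬝ᵥ momentPoint d t) * (f ⬝ᵥ divertedDirection φ t)} ⊆ (D.roots.toFinset : Set F) := by
    intro t ht
    have : D.eval t = 0 := by
      simp only [hD, Polynomial.eval_sub, Polynomial.eval_mul, vecPoly_eval_momentPoint,
        divertedPoly_eval]
      exact sub_eq_zero.2 ht
    simpa [hD0] using this
  refine (Set.encard_le_encard hsub).trans_lt ?_
  rw [Set.encard_coe_eq_coe_finsetCard]
  have h1 := D.roots.toFinset_card_le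
  have h2 := D.card_roots'
  exact_mod_cast (show D.roots.toFinset.card < 2 * d - 1 by omega)

/-! ### Diverted tangent lines generate -/

theorem submodule_divertedTangent {F : Type*} [Field F] {d : ℕ} (φ : Fin (d + 1) → F) (t : F) :
    Projectivization.Subspace.submodule (divertedTangent φ t) =
      Submodule.span F {momentPoint d t, divertedDirection φ t} :=
  OrderIso.apply_symm_apply _ _

theorem isLine_divertedTangent {F : Type*} [Field F] {d : ℕ} (hd : 1 ≤ d) {φ : Fin (d + 1) → F}
    (h1 : φ 1 = 1) (t : F) : IsLine (divertedTangent φ t) := by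
  obtain ⟨d, rfl⟩ : ∃ e, d = e + 1 := ⟨d - 1, by omega⟩
  rw [IsLine, submodule_divertedTangent]
  have hli : LinearIndependent F ![momentPoint (d + 1) t, divertedDirection φ t] := by
    rw [LinearIndependent.pair_iff]
    intro a b hab
    have ha : a = 0 := by
      simpa [momentPoint, divertedDirection] using congrFun hab 0
    have hb := congrFun hab 1
    have h1' : φ (Fin.succ 0) = 1 := h1
    rw [show (1 : Fin (d + 1 + 1)) = Fin.succ 0 from rfl] at hb
    simp only [ha, divertedDirection, Pi.add_apply, Pi.smul_apply, Fin.cons_succ, h1'] at hb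
    exact ⟨ha, by simpa using hb⟩
  have := finrank_span_eq_card hli
  rw [Matrix.range_cons, Matrix.range_cons, Matrix.range_empty, Set.union_empty] at this
  exact this

/-- A line and a hyperplane have a common point. -/
theorem exists_ne_zero_mem_inf {d : ℕ} {F : Type*} [Field F] {l P : PGSubspace d F}
    (hl : IsLine l) (hP : IsHyperplane P) :
    ∃ x ≠ 0, x ∈ Projectivization.Subspace.submodule l ∧
      x ∈ Projectivization.Subspace.submodule P := by
  have h := Submodule.finrank_sup_add_finrank_inf_eq
    (Projectivization.Subspace.submodule l) (Projectivization.Subspace.submodule P)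
  have h2 := Submodule.finrank_le
    (Projectivization.Subspace.submodule l ⊔ Projectivization.Subspace.submodule P)
  rw [Module.finrank_fin_fun] at h2
  rw [IsLine] at hl
  rw [IsHyperplane] at hP
  have hne : Projectivization.Subspace.submodule l ⊓ Projectivization.Subspace.submodule P ≠ ⊥ := by
    intro hbot
    rw [hbot, finrank_bot] at h
    omega
  obtain ⟨x, hx, hx0⟩ := Submodule.exists_mem_ne_zero_of_ne_bot hne
  exact ⟨x, hx0, hx.1, hx.2⟩

/-- Any `2 d - 1` diverted tangent lines form a generator set. -/
theorem isGeneratorSetOfLines_image_divertedTangent {F : Type*} [Field F] {d : ℕ} (hd : 1 ≤ d)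
    {φ : Fin (d + 1) → F} (hφ : Function.Injective φ) (h0 : φ 0 = 0) (h1 : φ 1 = 1)
    {T : Set F} (hT : ((2 * d - 1 : ℕ) : ℕ∞) ≤ T.encard) :
    IsGeneratorSetOfLines (divertedTangent φ '' T) := by
  refine ⟨?_, fun P hP => ?_⟩
  · rintro _ ⟨t, -, rfl⟩
    exact isLine_divertedTangent hd h1 t
  set G := ⋃ l ∈ divertedTangent φ '' T, (l : Set (PG d F))
  have hle : Projectivization.Subspace.span (G ∩ P) ≤ P :=
    Projectivization.Subspace.span_le_subspace_iff.2 Set.inter_subset_right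
  by_contra hne
  have hlt : Projectivization.Subspace.submodule (Projectivization.Subspace.span (G ∩ P)) <
      Projectivization.Subspace.submodule P :=
    Projectivization.Subspace.submodule.lt_iff_lt.2 (lt_of_le_of_ne hle hne)
  -- The form `g` vanishes on `P`, while `f` vanishes on the span of the points but not at `w`, so
  -- `f` is no multiple of `g`.
  obtain ⟨w, hwP, hw⟩ := SetLike.exists_of_lt hlt
  obtain ⟨g', hg', hgP⟩ := Submodule.exists_le_ker_of_lt_top
    (Projectivization.Subspace.submodule P) (by
      refine lt_top_iff_ne_top.2 fun htop => ?_
      rw [IsHyperplane, htop, finrank_top, Module.finrank_fin_fun] at hP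
      omega)
  obtain ⟨f', hfw, hfK⟩ := Submodule.exists_le_ker_of_notMem hw
  obtain ⟨g, rfl⟩ := (dotProductEquiv F (Fin (d + 1))).surjective g'
  obtain ⟨f, rfl⟩ := (dotProductEquiv F (Fin (d + 1))).surjective f'
  have hg : g ≠ 0 := by rintro rfl; simp at hg'
  have hfg : ∀ c : F, f ≠ c • g := by
    rintro c rfl
    have : g ⬝ᵥ w = 0 := hgP hwP
    simp [this] at hfw
  refine absurd hT (not_le.2 ((Set.encard_le_encard fun t ht => ?_).trans_lt
    (encard_minor_eq_zero_lt hd hφ h0 hg hfg)))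
  obtain ⟨x, hx, hxl, hxP⟩ := exists_ne_zero_mem_inf (isLine_divertedTangent hd h1 t) hP
  have hxK : x ∈ Projectivization.Subspace.submodule (Projectivization.Subspace.span (G ∩ P)) :=
    (Projectivization.Subspace.mem_submodule_iff _ hx).2 <|
      Projectivization.Subspace.subset_span _
        ⟨Set.mem_iUnion₂.2 ⟨_, ⟨t, ht, rfl⟩,
          (Projectivization.Subspace.mem_submodule_iff _ hx).1 hxl⟩,
          (Projectivization.Subspace.mem_submodule_iff _ hx).1 hxP⟩
  have hfx : f ⬝ᵥ x = 0 := hfK hxK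
  have hgx : g ⬝ᵥ x = 0 := hgP hxP
  rw [submodule_divertedTangent, Submodule.mem_span_pair] at hxl
  obtain ⟨a, b, rfl⟩ := hxl
  simp only [dotProduct_add, dotProduct_smul, smul_eq_mul] at hfx hgx
  rw [Set.mem_ofPred_eq, ← sub_eq_zero]
  -- Cramer's rule: a nonzero determinant would force `x = 0`.
  by_contra hdet
  have ha : a = 0 := by
    refine (mul_eq_zero.1 (?_ : a * _ = 0)).resolve_right hdet
    linear_combination (g ⬝ᵥ divertedDirection φ t) * hfx - (f ⬝ᵥ divertedDirection φ t) * hgx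
  have hb : b = 0 := by
    refine (mul_eq_zero.1 (?_ : b * _ = 0)).resolve_right hdet
    linear_combination (f ⬝ᵥ momentPoint d t) * hgx - (g ⬝ᵥ momentPoint d t) * hfx
  exact hx (by simp [ha, hb])

/-- An infinite field admits an injective weight with prescribed first two values. -/
theorem exists_injective_zero_one (F : Type*) [Field F] [Infinite F] {d : ℕ} (hd : 1 ≤ d) :
    ∃ φ : Fin (d + 1) → F, Function.Injective φ ∧ φ 0 = 0 ∧ φ 1 = 1 := by
  classical
  let e : Fin (d + 1) ↪ F := Fin.valEmbedding.trans (Infinite.natEmbedding F)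
  have hne : (0 : Fin (d + 1)) ≠ 1 := by
    intro h
    have := Fin.zero_eq_one_iff.1 h
    omega
  have hsub : e 1 - e 0 ≠ 0 := sub_ne_zero.2 fun h => hne (e.injective h).symm
  refine ⟨fun i => (e i - e 0) / (e 1 - e 0), fun i j hij => ?_, by simp, div_self hsub⟩
  exact e.injective (sub_left_injective ((div_left_inj' hsub).1 hij))

theorem mainTheorem4 {F : Type*} [Field F] [IsAlgClosed F] (d : ℕ) (hd : 1 ≤ d) :
    IsLeast {n : ℕ∞ | ∃ L : Set (PGSubspace d F), IsGeneratorSetOfLines L ∧ L.encard = n}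
      ((2 * d - 1 : ℕ) : ℕ∞) ∧
    ∀ φ : Fin (d + 1) → F, Function.Injective φ → φ 0 = 0 → φ 1 = 1 →
      ∀ S : Set (PGSubspace d F), S ⊆ Set.range (divertedTangent φ) →
        S.encard = ((2 * d - 1 : ℕ) : ℕ∞) →
          IsGeneratorSetOfLines S ∧
            ∀ L : Set (PGSubspace d F), IsGeneratorSetOfLines L → S.encard ≤ L.encard := by
  refine ⟨⟨?_, ?_⟩, fun φ hφ h0 h1 S hS hcard => ⟨?_, fun L hL => ?_⟩⟩
  · have : Infinite F := IsAlgClosed.instInfinite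
    obtain ⟨φ, hφ, h0, h1⟩ := exists_injective_zero_one F hd
    obtain ⟨T, -, hT⟩ := Set.exists_subset_encard_eq (s := (Set.univ : Set F))
      (k := ((2 * d - 1 : ℕ) : ℕ∞)) (by simp)
    have hgen := isGeneratorSetOfLines_image_divertedTangent hd hφ h0 h1 hT.ge
    -- The lower bound itself shows that no two parameters in `T` give the same line.
    exact ⟨_, hgen, le_antisymm ((Set.encard_image_le _ _).trans hT.le)
      (le_encard_of_isGeneratorSetOfLines hd hgen)⟩
  · rintro n ⟨L, hL, rfl⟩
    exact le_encard_of_isGeneratorSetOfLines hd hL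
  -- The preimage of `S` has at least as many parameters as `S` has lines, so injectivity of the
  -- parametrisation is not needed.
  · rw [← Set.image_preimage_eq_of_subset hS] at hcard ⊢
    exact isGeneratorSetOfLines_image_divertedTangent hd hφ h0 h1
      (hcard.ge.trans (Set.encard_image_le _ _))
  · exact hcard.le.trans (le_encard_of_isGeneratorSetOfLines hd hL)
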